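/- **Setting.** Let $m\ge 1$, let $A\in\mathbb{R}^{m\times n}$ have rank $m$, let $x,s\in\mathbb{R}^n$ have strictly positive entries, and put $X=\mathrm{diag}(x)$, $S=\mathrm{diag}(s)$, $D=X^{1/2}S^{-1/2}$. Let $M^\dagger$ denote the Moore–Penrose pseudoinverse of a matrix $M$. For a matrix $W\in\mathbb{R}^{n\times w}$ and vectors $\widehat{\Delta y},p\in\mathbb{R}^m$ define the perturbation vector $$v=(XS)^{1/2}\,W\,(ADW)^\dagger\,\bigl(AD^2A^{\mathsf T}\widehat{\Delta y}-p\bigr)\in\mathbb{R}^n .$$ Let $0<\delta<1$. **Sketching matrix.** A random matrix $W\in\mathbb{R}^{n\times w}$ satisfies the *sketching guarantee* with accuracy $\zeta$, failure probability $\delta$ and parameter $r\geq 1$ if for every matrix $Z$ with $n$ columns, with probability at least $1-\delta$, $$\|ZWW^{\mathsf T}Z^{\mathsf T}-ZZ^{\mathsf T}\|_2\le\frac{\zeta}{4}\Bigl(\|Z\|_2^2+\frac{\|Z\|_F^2}{r}\Bigr).$$ The *sparse sketching matrix* with $q$ blocks of $t$ buckets is the random matrix $W\in\mathbb{R}^{n\times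 qt}$ obtained by placing $q$ independent count sketches $\Phi_1,\dots,\Phi_q\in\mathbb{R}^{n\times t}$ side by side and scaling by $1/\sqrt q$; each row of each $\Phi_a$ has exactly one nonzero entry, in a uniformly random column and equal to a uniformly random sign, all these choices being independent. So $W$ has exactly $q$ nonzero entries per row. **Lemma.** Consider the event $$\mathcal{E}:\quad \operatorname{rank}(ADW)=m\ \text{ and, for all } \widehat{\Delta y},p\in\mathbb{R}^m,\ \text{ the vector } v \text{ satisfies exactly }\ AS^{-1}v=AD^2A^{\mathsf T}\widehat{\Delta y}-p .$$ 1. There is an absolute constant $C>0$ such that, for all $m,n,A,x,s,\delta$ as above, if $W$ is the sparse sketching matrix with any $q\ge C\log(m/\delta)$ and $t\ge Cm$, then $\Pr[\mathcal{E}]\ge 1-\delta$. (In particular $W$ can be taken with $w=qt=O(m\log(m/\delta))$ columns and $O(\log(m/\delta))$ nonzero entries per row.) 2. For all $m,n,A,x,s,\delta$ as above, if $W\in\mathbb{R}^{n\times w}$ is any random matrix that satisfies the sketching guarantee with some accuracy $\zeta\in[0,1]$, failure probability $\delta$ and parameter $r=m$, then $\Pr[\mathcal{E}]\ge 1-\delta$.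 -/

import Mathlib

/-- The Moore-Penrose pseudoinverse of a real matrix, `M† = Mᵀ (M Mᵀ)†`, where the pseudoinverse
of the symmetric matrix `M Mᵀ = U diag(lam) Uᵀ` is `U diag(lam⁻¹) Uᵀ` with `0⁻¹ = 0`.
The four Penrose equations, which characterise it, are proved in `pinv_spec`. -/
noncomputable def pinv {m k : ℕ} (M : Matrix (Fin m) (Fin k) ℝ) : Matrix (Fin k) (Fin m) ℝ :=
  let h : (M * M.transpose).IsHermitian := by
    simpa using Matrix.isHermitian_mul_conjTranspose_self M
  let U : Matrix (Fin m) (Fin m) ℝ := (h.eigenvectorUnitary : Matrix (Fin m) (Fin m) ℝ)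
  M.transpose * (U * Matrix.diagonal (fun i => (h.eigenvalues i)⁻¹) * U.transpose)

/-- `pinv M` satisfies the four Penrose equations. -/
theorem pinv_spec {m k : ℕ} (M : Matrix (Fin m) (Fin k) ℝ) :
    M * pinv M * M = M ∧ pinv M * M * pinv M = pinv M ∧
      (M * pinv M).transpose = M * pinv M ∧ (pinv M * M).transpose = pinv M * M := by
  have h : (M * M.transpose).IsHermitian := by
    simpa using Matrix.isHermitian_mul_conjTranspose_self M
  obtain ⟨U, hU⟩ : ∃ U : Matrix (Fin m) (Fin m) ℝ,
      U = (h.eigenvectorUnitary : Matrix (Fin m) (Fin m) ℝ) := ⟨_, rfl⟩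
  have hst : star U = U.transpose := by
    ext i j
    simp [Matrix.star_apply]
  have hUU : U.transpose * U = 1 := by
    rw [← hst, hU]
    exact Unitary.coe_star_mul_self h.eigenvectorUnitary
  obtain ⟨L, hL⟩ : ∃ L : Fin m → ℝ, L = h.eigenvalues := ⟨_, rfl⟩
  have hG : M * M.transpose = U * Matrix.diagonal L * U.transpose := by
    have := h.spectral_theorem
    rw [Unitary.conjStarAlgAut_apply] at this
    rw [← hst, hU, hL]
    exact this
  have hP : pinv M
      = M.transpose * (U * Matrix.diagonal (fun i => (L i)⁻¹) * U.transpose) := by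
    rw [hU, hL]
    rfl
  obtain ⟨K, hK⟩ : ∃ K : Matrix (Fin m) (Fin m) ℝ,
      K = U * Matrix.diagonal (fun i => (L i)⁻¹) * U.transpose := ⟨_, rfl⟩
  rw [← hK] at hP
  obtain ⟨G, hGd⟩ : ∃ G : Matrix (Fin m) (Fin m) ℝ, G = M * M.transpose := ⟨_, rfl⟩
  rw [← hGd] at hG
  have conj : ∀ a b : Fin m → ℝ,
      (U * Matrix.diagonal a * U.transpose) * (U * Matrix.diagonal b * U.transpose)
        = U * Matrix.diagonal (fun i => a i * b i) * U.transpose := by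
    intro a b
    calc _ = U * Matrix.diagonal a * (U.transpose * U) * Matrix.diagonal b * U.transpose := by
          simp only [Matrix.mul_assoc]
      _ = _ := by rw [hUU, Matrix.mul_one, Matrix.mul_assoc U, Matrix.diagonal_mul_diagonal]
  have hKt : K.transpose = K := by
    rw [hK]
    simp [Matrix.transpose_mul, Matrix.mul_assoc]
  have hGt : G.transpose = G := by
    rw [hGd]
    simp [Matrix.transpose_mul]
  have hGKG : G * K * G = G := by
    rw [hG, hK, conj, conj]
    congr 3
    funext i
    by_cases hi : L i = 0 <;> simp [hi]
  have hKGK : K * G * K = K := by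
    rw [hG, hK, conj, conj]
    congr 3
    funext i
    by_cases hi : L i = 0 <;> simp [hi]
  have hGK : G * K = K * G := by
    rw [hG, hK, conj, conj]
    congr 3
    funext i
    ring
  have h1 : G * K * M = M := by
    have hz : (G * K * M - M) * (G * K * M - M).transpose = 0 := by
      rw [Matrix.transpose_sub, Matrix.transpose_mul, Matrix.transpose_mul, hKt, hGt]
      calc _ = G * K * (M * M.transpose) * (K * G) - G * K * (M * M.transpose)
            - (M * M.transpose) * (K * G) + M * M.transpose := by
              simp only [Matrix.mul_assoc, Matrix.sub_mul, Matrix.mul_sub]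
              abel
        _ = 0 := by
              rw [← hGd, hGKG, ← Matrix.mul_assoc, hGKG]
              abel
    have hz2 := (Matrix.self_mul_conjTranspose_eq_zero (A := G * K * M - M)).mp (by simpa using hz)
    exact sub_eq_zero.mp hz2
  have hMP : M * pinv M = G * K := by
    rw [hP, ← Matrix.mul_assoc, ← hGd]
  refine ⟨?_, ?_, ?_, ?_⟩
  · rw [hMP, h1]
  · rw [Matrix.mul_assoc, hMP, hP, Matrix.mul_assoc, ← Matrix.mul_assoc K, hKGK]
  · rw [hMP, Matrix.transpose_mul, hKt, hGt, hGK]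
  · rw [hP]
    simp [Matrix.transpose_mul, hKt, Matrix.mul_assoc]

/-- The scaling matrix `D = X^{1/2} S^{-1/2}`, with `X = diag(x)` and `S = diag(s)`. -/
noncomputable def scaling {n : ℕ} (x s : Fin n → ℝ) : Matrix (Fin n) (Fin n) ℝ :=
  Matrix.diagonal (fun i => √(x i)) * (Matrix.diagonal (fun i => √(s i)))⁻¹

/-- The perturbation vector `v = (X S)^{1/2} W (A D W)† (A D² Aᵀ dy - p)`. -/
noncomputable def perturbation {m n w : ℕ} (A : Matrix (Fin m) (Fin n) ℝ) (x s : Fin n → ℝ)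
    (W : Matrix (Fin n) (Fin w) ℝ) (dy p : Fin m → ℝ) : Fin n → ℝ :=
  (Matrix.diagonal (fun i => √(x i * s i)) * W * pinv (A * scaling x s * W)).mulVec
    ((A * scaling x s ^ 2 * A.transpose).mulVec dy - p)

/-- The product (Borel) sigma-algebra on real matrices. -/
instance instMeasurableSpaceRealMatrix {n w : ℕ} :
    MeasurableSpace (Matrix (Fin n) (Fin w) ℝ) :=
  inferInstanceAs (MeasurableSpace (Fin n → Fin w → ℝ))

section Norms

open scoped Matrix.Norms.L2Operator

/-- The sketching guarantee, with accuracy `ζ`, failure probability `δ` and rank parameter `r`,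
for a random `n × w` matrix `W` with law `P`: for every matrix `Z` with `n` columns,
`‖Z W Wᵀ Zᵀ - Z Zᵀ‖₂ ≤ (ζ / 4) (‖Z‖₂² + ‖Z‖_F² / r)` with probability at least `1 - δ`.
Here `‖·‖` is the spectral norm, and the squared Frobenius norm is the sum of the squared
entries. -/
def SketchGuarantee {n w : ℕ} (P : MeasureTheory.Measure (Matrix (Fin n) (Fin w) ℝ))
    (ζ δ r : ℝ) : Prop :=
  ∀ (k : ℕ) (Z : Matrix (Fin k) (Fin n) ℝ),
    ENNReal.ofReal (1 - δ) ≤ P {W | ‖Z * W * W.transpose * Z.transpose - Z * Z.transpose‖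
      ≤ ζ / 4 * (‖Z‖ ^ 2 + (∑ i, ∑ j, Z i j ^ 2) / r)}

end Norms

/-- The sparse (OSNAP) sketching matrix made of `q` count sketches with `t` buckets each, put side
by side and scaled by `1/√q`. Row `i` sends its only nonzero entry of block `a` to the
bucket `(ω i a).1`, with the sign given by `(ω i a).2`, so a row has exactly `q` nonzero entries.
The column with index `j : Fin (q * t)` is bucket `j.modNat` of block `j.divNat`. -/
noncomputable def sparseSketch {n q t : ℕ} (ω : Fin n → Fin q → Fin t × Bool) :
    Matrix (Fin n) (Fin (q * t)) ℝ :=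
  Matrix.of fun i j =>
    if (ω i j.divNat).1 = j.modNat then (if (ω i j.divNat).2 then 1 else -1) / √(q : ℝ) else 0

/-- The law of the sparse sketching matrix: all hash values and all signs are independent and
uniformly distributed. -/
noncomputable def sparseSketchLaw (n q t : ℕ) :
    MeasureTheory.Measure (Matrix (Fin n) (Fin (q * t)) ℝ) :=
  (ProbabilityTheory.uniformOn (Set.univ : Set (Fin n → Fin q → Fin t × Bool))).map sparseSketch

theorem sparseSketchLaw_isProbabilityMeasure (n q t : ℕ) (ht : 0 < t) :
    MeasureTheory.IsProbabilityMeasure (sparseSketchLaw n q t) := by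
  have : Nonempty (Fin t) := ⟨⟨0, ht⟩⟩
  have := ProbabilityTheory.isProbabilityMeasure_uniformOn
    (s := (Set.univ : Set (Fin n → Fin q → Fin t × Bool))) Set.finite_univ Set.univ_nonempty
  have hmeas : Measurable (sparseSketch : (Fin n → Fin q → Fin t × Bool) → _) :=
    measurable_of_countable _
  exact MeasureTheory.Measure.isProbabilityMeasure_map hmeas.aemeasurable

/-! Since `S⁻¹ (XS)^{1/2} = D`, the left side of the equation is `(ADW)(ADW)†` applied to the right
side, and `M M† = 1` once `M` has full row rank. So everything reduces to `rank (ADW) = m`, that is,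
to `Wᵀ` being injective on the row space `L` of `AD`.

For the sparse sketch no subspace embedding is needed: it suffices to follow the dimension of the
part of `L` that the blocks kill. If `Φᵀ` kills a subspace `K` of a `d`-dimensional `L`, the error
of `Φ Φᵀ`, compressed to `L`, is the identity on `K`, so its squared Frobenius norm is at least `dim
K` (`finrank_le_sum_inner_sq`). That norm has mean at most `2d²/t`, which is at most `d/e` when `t ≥
6m`. By independence each further block shrinks the surviving dimension by a factor `1/e` on average
(`sum_finrank_inf_iInf_le`), so the mean after `q` blocks is at most `m e^{-q} ≤ δ`. A dimension is
an integer, so it is nonzero with probability at most `δ`.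

Under the sketching guarantee, apply the bound to an orthonormal basis of `L`: the error is at most
`1/2`, which excludes a kernel. -/

/-- The `n × t` count sketch with hash values `(h i).1` and signs `(h i).2`. -/
noncomputable def countSketch {n t : ℕ} (h : Fin n → Fin t × Bool) : Matrix (Fin n) (Fin t) ℝ :=
  Matrix.of fun i b => if (h i).1 = b then (if (h i).2 then 1 else -1) else 0

/-- The entries of `Φ Φᵀ` for the count sketch `Φ`: the product of the signs of `i` and `j` if they
share a bucket, and `0` otherwise. -/
noncomputable def collision {n t : ℕ} (h : Fin n → Fin t × Bool) (i j : Fin n) : ℝ :=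
  if (h i).1 = (h j).1 then (if (h i).2 then 1 else -1) * (if (h j).2 then 1 else -1) else 0

/-! ### Second moments of a count sketch. -/

section CountSketch

variable {n t : ℕ}

theorem countSketch_mul_transpose_apply (h : Fin n → Fin t × Bool) (i j : Fin n) :
    (countSketch h * (countSketch h).transpose) i j = collision h i j := by
  simp only [countSketch, collision, Matrix.mul_apply, Matrix.transpose_apply, Matrix.of_apply,
    ite_mul, zero_mul, Finset.sum_ite_eq, Finset.mem_univ, if_true]
  by_cases e : (h i).1 = (h j).1
  · simp [e]
  · simp [e, Ne.symm e]

theorem collision_self (h : Fin n → Fin t × Bool) (i : Fin n) : collision h i i = 1 := by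
  unfold collision
  split_ifs <;> simp_all

theorem collision_comm (h : Fin n → Fin t × Bool) (i j : Fin n) :
    collision h i j = collision h j i := by
  simp only [collision, eq_comm (a := (h i).1), mul_comm]

theorem collision_sq (h : Fin n → Fin t × Bool) (i j : Fin n) :
    collision h i j ^ 2 = if (h i).1 = (h j).1 then 1 else 0 := by
  unfold collision
  split_ifs <;> norm_num

/-- Flip the sign of row `p`. -/
def flipSign (p : Fin n) (h : Fin n → Fin t × Bool) : Fin n → Fin t × Bool :=
  Function.update h p ((h p).1, !(h p).2)

theorem flipSign_involutive (p : Fin n) :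
    Function.Involutive (flipSign p : (Fin n → Fin t × Bool) → _) := by
  intro h
  simp [flipSign]

theorem collision_flipSign_left {i j : Fin n} (hij : i ≠ j) (h : Fin n → Fin t × Bool) :
    collision (flipSign i h) i j = -collision h i j := by
  unfold collision flipSign
  rw [Function.update_self, Function.update_of_ne hij.symm]
  cases (h i).2 <;> split_ifs <;> simp_all

theorem collision_flipSign_right {i j : Fin n} (hij : i ≠ j) (h : Fin n → Fin t × Bool) :
    collision (flipSign j h) i j = -collision h i j := by
  rw [collision_comm, collision_flipSign_left hij.symm, collision_comm]

theorem collision_flipSign_of_ne {p i j : Fin n} (hi : i ≠ p) (hj : j ≠ p)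
    (h : Fin n → Fin t × Bool) : collision (flipSign p h) i j = collision h i j := by
  unfold collision flipSign
  rw [Function.update_of_ne hi, Function.update_of_ne hj]

theorem sum_eq_zero_of_flipSign (p : Fin n) (f : (Fin n → Fin t × Bool) → ℝ)
    (hf : ∀ h, f (flipSign p h) = -f h) : ∑ h, f h = 0 := by
  have h1 : ∑ h, f (flipSign p h) = ∑ h, f h :=
    Fintype.sum_bijective _ (flipSign_involutive p).bijective _ _ fun _ => rfl
  simp only [hf, Finset.sum_neg_distrib] at h1
  linarith

/-- Two distinct ordered pairs differ in some index of the first pair; flipping the sign of that row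
negates the product. -/
theorem sum_collision_mul_collision {i j k l : Fin n} (hij : i < j) (hkl : k < l)
    (hne : (i, j) ≠ (k, l)) :
    ∑ h : Fin n → Fin t × Bool, collision h i j * collision h k l = 0 := by
  by_cases hi : k ≠ i ∧ l ≠ i
  · refine sum_eq_zero_of_flipSign i _ fun h => ?_
    rw [collision_flipSign_left hij.ne, collision_flipSign_of_ne hi.1 hi.2, neg_mul]
  · have hj : k ≠ j ∧ l ≠ j := by
      constructor
      · rintro rfl
        exact hi ⟨hij.ne', (hij.trans hkl).ne'⟩
      · rintro rfl
        refine hi ⟨?_, hij.ne'⟩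
        rintro rfl
        exact hne rfl
    refine sum_eq_zero_of_flipSign j _ fun h => ?_
    rw [collision_flipSign_right hij.ne, collision_flipSign_of_ne hj.1 hj.2, neg_mul]

theorem sum_collision_sq {i j : Fin n} (hij : i ≠ j) :
    (t : ℝ) * ∑ h : Fin n → Fin t × Bool, collision h i j ^ 2
      = Fintype.card (Fin n → Fin t × Bool) := by
  rcases Nat.eq_zero_or_pos t with rfl | ht
  · have : IsEmpty (Fin n → Fin 0 × Bool) := ⟨fun h => (h i).1.elim0⟩
    simp
  have : NeZero t := ⟨ht.ne'⟩
  -- Shifting the bucket of row `i` cyclically is a bijection, so all `t` values of the bucket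
  -- difference are equally frequent.
  have hshift : ∀ s : Fin t, ∑ h : Fin n → Fin t × Bool, collision h i j ^ 2
      = ∑ h : Fin n → Fin t × Bool, if s = (h i).1 - (h j).1 then (1 : ℝ) else 0 := by
    intro s
    have hbij : Function.Bijective
        (fun h : Fin n → Fin t × Bool => Function.update h i ((h i).1 - s, (h i).2)) := by
      refine Function.bijective_iff_has_inverse.mpr
        ⟨fun h => Function.update h i ((h i).1 + s, (h i).2), fun h => ?_, fun h => ?_⟩ <;> simp
    refine (Fintype.sum_bijective _ hbij _ _ fun h => ?_).symm
    rw [collision_sq, Function.update_self, Function.update_of_ne hij.symm]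
    refine if_congr ?_ rfl rfl
    constructor
    · rintro rfl
      simp
    · intro e
      simp only at e
      rw [← e]
      simp
  calc (t : ℝ) * ∑ h : Fin n → Fin t × Bool, collision h i j ^ 2
      = ∑ s : Fin t, ∑ h : Fin n → Fin t × Bool,
          if s = (h i).1 - (h j).1 then (1 : ℝ) else 0 := by
        rw [← Finset.sum_congr rfl fun s _ => hshift s]
        simp
    _ = _ := by
        rw [Finset.sum_comm]
        simp

/-- The collision variables of distinct pairs are orthogonal, with second moment `1 / t`. -/
theorem sum_sum_collision_sq (c : Fin n × Fin n → ℝ) :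
    (t : ℝ) * ∑ h : Fin n → Fin t × Bool,
        (∑ p with p.1 < p.2, c p * collision h p.1 p.2) ^ 2
      = Fintype.card (Fin n → Fin t × Bool) * ∑ p : Fin n × Fin n with p.1 < p.2, c p ^ 2 := by
  simp only [sq (∑ p with _, _), Finset.sum_mul_sum]
  rw [Finset.sum_comm, Finset.mul_sum, Finset.mul_sum]
  refine Finset.sum_congr rfl fun p hp => ?_
  have hp' : p.1 < p.2 := (Finset.mem_filter.mp hp).2
  rw [Finset.sum_comm, Finset.sum_eq_single_of_mem p hp]
  · rw [← sum_collision_sq (t := t) hp'.ne, mul_assoc, Finset.sum_mul]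
    congr 1
    exact Finset.sum_congr rfl fun h _ => by ring
  · intro r hr hne
    have hr' : r.1 < r.2 := (Finset.mem_filter.mp hr).2
    calc _ = c p * c r * ∑ h : Fin n → Fin t × Bool,
          collision h p.1 p.2 * collision h r.1 r.2 := by
            rw [Finset.mul_sum]
            exact Finset.sum_congr rfl fun h _ => by ring
      _ = 0 := by rw [sum_collision_mul_collision hp' hr' fun e => hne e.symm, mul_zero]

theorem sum_offDiag_eq (f : Fin n → Fin n → ℝ) :
    ∑ i, ∑ j, f i j = ∑ i, f i i + (∑ p : Fin n × Fin n with p.1 < p.2, f p.1 p.2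
      + ∑ p : Fin n × Fin n with p.1 < p.2, f p.2 p.1) := by
  have hswap : ∑ p : Fin n × Fin n with p.1 < p.2, f p.2 p.1
      = ∑ p : Fin n × Fin n with p.2 < p.1, f p.1 p.2 := by
    refine Finset.sum_equiv (Equiv.prodComm _ _) (fun p => ?_) fun p _ => rfl
    simp
  have hdiag : ∑ i, f i i = ∑ p : Fin n × Fin n with p.1 = p.2, f p.1 p.2 := by
    rw [Finset.sum_filter, Fintype.sum_prod_type]
    simp
  rw [hswap, hdiag, ← Fintype.sum_prod_type' f]
  simp only [Finset.sum_filter, ← Finset.sum_add_distrib]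
  refine Finset.sum_congr rfl fun p _ => ?_
  rcases lt_trichotomy p.1 p.2 with hlt | heq | hgt
  · simp [hlt, hlt.ne, hlt.not_gt]
  · simp [heq]
  · simp [hgt, hgt.ne', hgt.not_gt]

/-- The second moment of the error of a count sketch on a bilinear form. -/
theorem sum_sub_bilinear_sq_le (u v : Fin n → ℝ) :
    (t : ℝ) * ∑ h : Fin n → Fin t × Bool,
        (u ⬝ᵥ v - (u ⬝ᵥ (countSketch h * (countSketch h).transpose).mulVec v)) ^ 2
      ≤ Fintype.card (Fin n → Fin t × Bool) * (2 * ((∑ i, u i ^ 2) * ∑ i, v i ^ 2)) := by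
  have key : ∀ h : Fin n → Fin t × Bool,
      (u ⬝ᵥ v - (u ⬝ᵥ (countSketch h * (countSketch h).transpose).mulVec v)) ^ 2
        ≤ 2 * ((∑ p : Fin n × Fin n with p.1 < p.2, (u p.1 * v p.2) * collision h p.1 p.2) ^ 2
          + (∑ p : Fin n × Fin n with p.1 < p.2, (u p.2 * v p.1) * collision h p.1 p.2) ^ 2) := by
    intro h
    have h1 : u ⬝ᵥ (countSketch h * (countSketch h).transpose).mulVec v
        = ∑ i, ∑ j, u i * v j * collision h i j := by
      simp only [dotProduct, Matrix.mulVec, countSketch_mul_transpose_apply, Finset.mul_sum]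
      exact Finset.sum_congr rfl fun i _ => Finset.sum_congr rfl fun j _ => by ring
    rw [h1, sum_offDiag_eq]
    -- The diagonal is reproduced exactly, so the error consists of the two off-diagonal triangles.
    simp only [collision_self, mul_one, fun i j => collision_comm h j i, dotProduct]
    have h3 : ∀ a b c : ℝ, (a - (a + (b + c))) ^ 2 ≤ 2 * (b ^ 2 + c ^ 2) := fun a b c => by
      nlinarith [sq_nonneg (b - c)]
    exact h3 _ _ _
  have hN : (0 : ℝ) ≤ Fintype.card (Fin n → Fin t × Bool) := Nat.cast_nonneg _
  calc _ ≤ (t : ℝ) * ∑ h : Fin n → Fin t × Bool,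
        2 * ((∑ p : Fin n × Fin n with p.1 < p.2, (u p.1 * v p.2) * collision h p.1 p.2) ^ 2
          + (∑ p : Fin n × Fin n with p.1 < p.2, (u p.2 * v p.1) * collision h p.1 p.2) ^ 2) :=
        mul_le_mul_of_nonneg_left (Finset.sum_le_sum fun h _ => key h) (Nat.cast_nonneg _)
    _ = Fintype.card (Fin n → Fin t × Bool) * (2 *
          (∑ p : Fin n × Fin n with p.1 < p.2, (u p.1 * v p.2) ^ 2
            + ∑ p : Fin n × Fin n with p.1 < p.2, (u p.2 * v p.1) ^ 2)) := by
        rw [← Finset.mul_sum, Finset.sum_add_distrib, mul_left_comm, mul_add,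
          sum_sum_collision_sq fun p => u p.1 * v p.2, sum_sum_collision_sq fun p => u p.2 * v p.1]
        ring
    _ ≤ _ := by
        -- The two triangles are the full double sum minus its nonnegative diagonal.
        have h4 := sum_offDiag_eq fun i j => (u i * v j) ^ 2
        have h5 : 0 ≤ ∑ i, (u i * v i) ^ 2 := Finset.sum_nonneg fun i _ => sq_nonneg _
        have h6 : (∑ i, u i ^ 2) * ∑ i, v i ^ 2 = ∑ i, ∑ j, (u i * v j) ^ 2 := by
          simp only [Finset.sum_mul_sum, mul_pow]
        rw [h6]
        refine mul_le_mul_of_nonneg_left ?_ hN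
        linarith

end CountSketch

/-! ### Dimension lost by one block, and by independent blocks. -/

open scoped InnerProductSpace

/-- If the vectors `z k` represent the coordinates of the orthonormal basis `b` of `L` on a subspace
`K ≤ L`, then the dimension of `K` is at most the squared Frobenius norm of `⟪z k, b l⟫`. -/
theorem finrank_le_sum_inner_sq {E ι : Type*} [NormedAddCommGroup E] [InnerProductSpace ℝ E]
    [FiniteDimensional ℝ E] [Fintype ι] {K L : Submodule ℝ E} (hKL : K ≤ L)
    (b : OrthonormalBasis ι ℝ L) (z : ι → E)
    (hz : ∀ k, ∀ u ∈ K, ⟪z k, u⟫_ℝ = ⟪(b k : E), u⟫_ℝ) :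
    (Module.finrank ℝ K : ℝ) ≤ ∑ k, ∑ l, ⟪z k, (b l : E)⟫_ℝ ^ 2 := by
  let w := stdOrthonormalBasis ℝ K
  have hw : Orthonormal ℝ fun j => (⟨(w j : E), hKL (w j).2⟩ : L) := by
    rw [orthonormal_iff_ite]
    intro i j
    exact orthonormal_iff_ite.mp w.orthonormal i j
  -- Parseval in `L` for the unit vector `w j`.
  have h1 : ∀ j, ∑ k, ⟪(b k : E), (w j : E)⟫_ℝ ^ 2 = 1 := by
    intro j
    have := b.sum_sq_norm_inner_right ⟨(w j : E), hKL (w j).2⟩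
    rw [hw.1 j] at this
    simpa using this
  -- Bessel for the projection of `z k` onto `L`, whose norm is then expanded in the basis `b`.
  have h2 : ∀ k, ∑ j, ⟪z k, (w j : E)⟫_ℝ ^ 2 ≤ ∑ l, ⟪z k, (b l : E)⟫_ℝ ^ 2 := by
    intro k
    have hP : ∀ u : L, ⟪z k, (u : E)⟫_ℝ = ⟪u, L.orthogonalProjectionOnto (z k)⟫_ℝ := by
      intro u
      rw [real_inner_comm, Submodule.inner_orthogonalProjectionOnto_eq_of_mem_left]
    have h3 := hw.sum_inner_products_le (L.orthogonalProjectionOnto (z k)) (s := Finset.univ)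
    rw [← b.sum_sq_norm_inner_right] at h3
    simp only [Real.norm_eq_abs, sq_abs, ← hP] at h3
    exact h3
  calc (Module.finrank ℝ K : ℝ)
      = ∑ j, ∑ k, ⟪(b k : E), (w j : E)⟫_ℝ ^ 2 := by simp [h1]
    _ = ∑ k, ∑ j, ⟪z k, (w j : E)⟫_ℝ ^ 2 := by
        rw [Finset.sum_comm]
        exact Finset.sum_congr rfl fun k _ => Finset.sum_congr rfl fun j _ => by
          rw [hz k _ (w j).2]
    _ ≤ _ := Finset.sum_le_sum fun k _ => h2 k

/-- The vectors that a count sketch maps to `0`. -/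
noncomputable def sketchKer {n t : ℕ} (h : Fin n → Fin t × Bool) :
    Submodule ℝ (EuclideanSpace ℝ (Fin n)) :=
  LinearMap.ker (Matrix.toEuclideanLin (countSketch h).transpose)

theorem mem_sketchKer {n t : ℕ} {h : Fin n → Fin t × Bool} {u : EuclideanSpace ℝ (Fin n)} :
    u ∈ sketchKer h ↔ (countSketch h).transpose.mulVec u.ofLp = 0 := by
  simp [sketchKer, Matrix.toLpLin_apply]

/-- The average dimension of the part of a subspace that is lost by a count sketch. -/
theorem sum_finrank_inf_sketchKer_le {n t : ℕ} (L : Submodule ℝ (EuclideanSpace ℝ (Fin n))) :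
    (t : ℝ) * ∑ h : Fin n → Fin t × Bool, (Module.finrank ℝ ↥(L ⊓ sketchKer h) : ℝ)
      ≤ Fintype.card (Fin n → Fin t × Bool) * (2 * (Module.finrank ℝ L : ℝ) ^ 2) := by
  let b := stdOrthonormalBasis ℝ L
  let G (h : Fin n → Fin t × Bool) : Matrix (Fin n) (Fin n) ℝ :=
    countSketch h * (countSketch h).transpose
  have hnorm : ∀ k, ∑ i, (b k : EuclideanSpace ℝ (Fin n)).ofLp i ^ 2 = 1 := by
    intro k
    rw [← EuclideanSpace.real_norm_sq_eq]
    have := b.orthonormal.1 k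
    rw [Submodule.coe_norm] at this
    rw [this, one_pow]
  have hinner : ∀ (h : Fin n → Fin t × Bool) (u v : EuclideanSpace ℝ (Fin n)),
      ⟪u - WithLp.toLp 2 ((G h).mulVec u.ofLp), v⟫_ℝ
        = u.ofLp ⬝ᵥ v.ofLp - u.ofLp ⬝ᵥ (G h).mulVec v.ofLp := by
    intro h u v
    have hGt : (G h).transpose = G h := by simp [G, Matrix.transpose_mul]
    rw [inner_sub_left, EuclideanSpace.inner_eq_star_dotProduct,
      EuclideanSpace.inner_eq_star_dotProduct]
    simp only [star_trivial]
    rw [dotProduct_comm, dotProduct_comm v.ofLp, Matrix.dotProduct_mulVec, ← Matrix.mulVec_transpose,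
      hGt]
  have hdim : ∀ h : Fin n → Fin t × Bool, (Module.finrank ℝ ↥(L ⊓ sketchKer h) : ℝ)
      ≤ ∑ k, ∑ l, ((b k).1.ofLp ⬝ᵥ (b l).1.ofLp
        - (b k).1.ofLp ⬝ᵥ (G h).mulVec (b l).1.ofLp) ^ 2 := by
    intro h
    -- The vector `z k` is the error of `Φ Φᵀ` at `b k`; against a vector killed by `Φᵀ` the
    -- correction term vanishes.
    have := finrank_le_sum_inner_sq (inf_le_left : L ⊓ sketchKer h ≤ L) b
      (fun k => (b k).1 - WithLp.toLp 2 ((G h).mulVec (b k).1.ofLp)) ?_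
    · simpa only [hinner] using this
    · intro k u hu
      have hu' := mem_sketchKer.mp hu.2
      rw [hinner, ← Matrix.mulVec_mulVec, hu', Matrix.mulVec_zero, dotProduct_zero, sub_zero,
        EuclideanSpace.inner_eq_star_dotProduct, star_trivial, dotProduct_comm]
  calc _ ≤ (t : ℝ) * ∑ h : Fin n → Fin t × Bool, ∑ k, ∑ l, ((b k).1.ofLp ⬝ᵥ (b l).1.ofLp
        - (b k).1.ofLp ⬝ᵥ (G h).mulVec (b l).1.ofLp) ^ 2 :=
        mul_le_mul_of_nonneg_left (Finset.sum_le_sum fun h _ => hdim h) (Nat.cast_nonneg _)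
    _ = ∑ k, ∑ l, (t : ℝ) * ∑ h : Fin n → Fin t × Bool, ((b k).1.ofLp ⬝ᵥ (b l).1.ofLp
        - (b k).1.ofLp ⬝ᵥ (G h).mulVec (b l).1.ofLp) ^ 2 := by
        rw [Finset.sum_comm, Finset.mul_sum]
        refine Finset.sum_congr rfl fun k _ => ?_
        rw [Finset.sum_comm, Finset.mul_sum]
    _ ≤ ∑ k : Fin (Module.finrank ℝ L), ∑ l : Fin (Module.finrank ℝ L),
        (Fintype.card (Fin n → Fin t × Bool) * 2 : ℝ) := by
        refine Finset.sum_le_sum fun k _ => Finset.sum_le_sum fun l _ => ?_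
        have := sum_sub_bilinear_sq_le (t := t) (b k).1.ofLp (b l).1.ofLp
        rwa [hnorm, hnorm, mul_one, mul_one] at this
    _ = _ := by
        simp
        ring

/-- If a random subspace meets every subspace `L` of dimension at most `d` in dimension at most
`c · dim L` on average, then `q` independent copies meet it in dimension at most `c ^ q · dim L`. -/
theorem sum_finrank_inf_iInf_le {V H : Type*} [AddCommGroup V] [Module ℝ V]
    [FiniteDimensional ℝ V] [Fintype H] (N : H → Submodule ℝ V) {c : ℝ} (hc : 0 ≤ c) {d : ℕ}
    (hN : ∀ L : Submodule ℝ V, Module.finrank ℝ L ≤ d →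
      ∑ h, (Module.finrank ℝ ↥(L ⊓ N h) : ℝ) ≤ Fintype.card H * (c * Module.finrank ℝ L))
    (q : ℕ) (L : Submodule ℝ V) (hL : Module.finrank ℝ L ≤ d) :
    ∑ ω : Fin q → H, (Module.finrank ℝ ↥(L ⊓ ⨅ a, N (ω a)) : ℝ)
      ≤ Fintype.card (Fin q → H) * (c ^ q * Module.finrank ℝ L) := by
  induction q generalizing L with
  | zero => simpa using Submodule.finrank_mono inf_le_left
  | succ q ih =>
    have hstep : ∀ h : H, ∑ ω : Fin q → H,
        (Module.finrank ℝ ↥(L ⊓ ⨅ a, N ((Fin.cons h ω : Fin (q + 1) → H) a)) : ℝ)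
          ≤ Fintype.card (Fin q → H) * (c ^ q * Module.finrank ℝ ↥(L ⊓ N h)) := by
      intro h
      -- After fixing the first block, the others act on the smaller space `L ⊓ N h`; hence the
      -- induction runs over all subspaces.
      have hinf : ∀ ω : Fin q → H, (L ⊓ ⨅ a, N ((Fin.cons h ω : Fin (q + 1) → H) a))
          = (L ⊓ N h) ⊓ ⨅ a, N (ω a) := by
        intro ω
        rw [inf_assoc]
        congr 1
        refine le_antisymm (le_inf (iInf_le_of_le 0 (by simp))
          (le_iInf fun a => iInf_le_of_le a.succ (by simp))) (le_iInf fun a => ?_)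
        refine Fin.cases ?_ (fun a => ?_) a
        · exact inf_le_left
        · exact inf_le_right.trans (iInf_le _ a)
      rw [Finset.sum_congr rfl fun ω _ => by rw [hinf ω]]
      exact ih _ ((Submodule.finrank_mono inf_le_left).trans hL)
    calc _ = ∑ h : H, ∑ ω : Fin q → H,
        (Module.finrank ℝ ↥(L ⊓ ⨅ a, N ((Fin.cons h ω : Fin (q + 1) → H) a)) : ℝ) := by
          rw [← Fintype.sum_prod_type']
          exact (Fintype.sum_equiv (Fin.consEquiv fun _ => H) _ _ fun _ => rfl).symm
      _ ≤ ∑ h : H, (Fintype.card (Fin q → H) * (c ^ q * Module.finrank ℝ ↥(L ⊓ N h)) : ℝ) :=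
          Finset.sum_le_sum fun h _ => hstep h
      _ = Fintype.card (Fin q → H) * c ^ q * ∑ h : H, (Module.finrank ℝ ↥(L ⊓ N h) : ℝ) := by
          rw [Finset.mul_sum]
          exact Finset.sum_congr rfl fun h _ => by ring
      _ ≤ Fintype.card (Fin q → H) * c ^ q * (Fintype.card H * (c * Module.finrank ℝ L)) :=
          mul_le_mul_of_nonneg_left (hN L hL) (by positivity)
      _ = _ := by
          simp only [Fintype.card_pi, Finset.prod_const, Finset.card_univ, Fintype.card_fin]
          push_cast
          ring

/-! ### Full row rank and the pseudoinverse. -/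

/-- The row space of a matrix. -/
noncomputable def rowSpace {m n : ℕ} (B : Matrix (Fin m) (Fin n) ℝ) :
    Submodule ℝ (EuclideanSpace ℝ (Fin n)) :=
  LinearMap.range (Matrix.toEuclideanLin B.transpose)

theorem transpose_mulVec_injective_of_rank_eq {m n : ℕ} {B : Matrix (Fin m) (Fin n) ℝ}
    (hB : B.rank = m) : Function.Injective B.transpose.mulVec := by
  have h := LinearMap.finrank_range_add_finrank_ker B.transpose.mulVecLin
  have hr : Module.finrank ℝ (LinearMap.range B.transpose.mulVecLin) = m := by
    rw [← Matrix.rank, Matrix.rank_transpose, hB]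
  rw [hr, Module.finrank_fin_fun, Nat.add_eq_left, Submodule.finrank_eq_zero] at h
  exact LinearMap.ker_eq_bot.mp h

theorem finrank_rowSpace {m n : ℕ} {B : Matrix (Fin m) (Fin n) ℝ} (hB : B.rank = m) :
    Module.finrank ℝ (rowSpace B) = m := by
  have hinj : Function.Injective (Matrix.toEuclideanLin B.transpose) := by
    intro u v huv
    rw [Matrix.toLpLin_apply, Matrix.toLpLin_apply] at huv
    exact WithLp.ofLp_injective 2
      (transpose_mulVec_injective_of_rank_eq hB (WithLp.toLp_injective 2 huv))
  rw [rowSpace, LinearMap.finrank_range_of_inj hinj, finrank_euclideanSpace_fin]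

/-- Right multiplication by `W` preserves the rank of `B` if `Wᵀ` is injective on the row space. -/
theorem rank_mul_eq_of_rowSpace {m n w : ℕ} {B : Matrix (Fin m) (Fin n) ℝ} (hB : B.rank = m)
    {W : Matrix (Fin n) (Fin w) ℝ}
    (h : ∀ u ∈ rowSpace B, W.transpose.mulVec u.ofLp = 0 → u = 0) : (B * W).rank = m := by
  have hinj : Function.Injective (B * W).transpose.mulVecLin := by
    rw [← LinearMap.ker_eq_bot, LinearMap.ker_eq_bot']
    intro y hy
    rw [Matrix.mulVecLin_apply, Matrix.transpose_mul, ← Matrix.mulVec_mulVec] at hy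
    have h0 := h (WithLp.toLp 2 (B.transpose.mulVec y))
      ⟨WithLp.toLp 2 y, by rw [Matrix.toLpLin_apply]⟩ hy
    apply transpose_mulVec_injective_of_rank_eq hB
    rw [Matrix.mulVec_zero]
    simpa using h0
  rw [← Matrix.rank_transpose, Matrix.rank, LinearMap.finrank_range_of_inj hinj,
    Module.finrank_fin_fun]

/-- The Penrose equations give `Mᵀ (M M†) = Mᵀ`, and the injective `Mᵀ` can be cancelled. -/
theorem mul_pinv_of_rank_eq {m k : ℕ} {M : Matrix (Fin m) (Fin k) ℝ} (hM : M.rank = m) :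
    M * pinv M = (1 : Matrix (Fin m) (Fin m) ℝ) := by
  have h1 : M.transpose * (M * pinv M) = M.transpose * (1 : Matrix (Fin m) (Fin m) ℝ) := by
    have h := pinv_spec M
    rw [Matrix.mul_one, ← h.2.2.1, ← Matrix.transpose_mul, h.1]
  ext i j
  have h2 := transpose_mulVec_injective_of_rank_eq hM (a₁ := (M * pinv M).mulVec (Pi.single j 1))
    (a₂ := (1 : Matrix (Fin m) (Fin m) ℝ).mulVec (Pi.single j 1))
    (by rw [Matrix.mulVec_mulVec, Matrix.mulVec_mulVec, h1])
  simpa using congrFun h2 i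

/-! ### The diagonal scalings and the exact equation. -/

section Scaling

variable {m n : ℕ} (A : Matrix (Fin m) (Fin n) ℝ) {x s : Fin n → ℝ}

theorem scaling_eq_diagonal (hs : ∀ i, 0 < s i) :
    scaling x s = Matrix.diagonal fun i => √(x i) * (√(s i))⁻¹ := by
  have h : (Matrix.diagonal fun i => √(s i))⁻¹ = Matrix.diagonal fun i => (√(s i))⁻¹ := by
    refine Matrix.inv_eq_right_inv ?_
    rw [Matrix.diagonal_mul_diagonal, ← Matrix.diagonal_one]
    congr 1
    funext i
    exact mul_inv_cancel₀ (Real.sqrt_pos.mpr (hs i)).ne'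
  rw [scaling, h, Matrix.diagonal_mul_diagonal]

theorem rank_mul_scaling (hx : ∀ i, 0 < x i) (hs : ∀ i, 0 < s i) :
    (A * scaling x s).rank = A.rank := by
  refine Matrix.rank_mul_eq_left_of_isUnit_det _ _ ?_
  rw [scaling_eq_diagonal hs, Matrix.det_diagonal, isUnit_iff_ne_zero, Finset.prod_ne_zero_iff]
  intro i _
  have := Real.sqrt_pos.mpr (hx i)
  have := Real.sqrt_pos.mpr (hs i)
  positivity

theorem inv_diagonal_mul_sqrt (hx : ∀ i, 0 < x i) (hs : ∀ i, 0 < s i) :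
    (Matrix.diagonal s)⁻¹ * Matrix.diagonal (fun i => √(x i * s i)) = scaling x s := by
  have h : (Matrix.diagonal s)⁻¹ = Matrix.diagonal fun i => (s i)⁻¹ := by
    refine Matrix.inv_eq_right_inv ?_
    rw [Matrix.diagonal_mul_diagonal, ← Matrix.diagonal_one]
    congr 1
    funext i
    exact mul_inv_cancel₀ (hs i).ne'
  rw [h, scaling_eq_diagonal hs, Matrix.diagonal_mul_diagonal]
  congr 1
  funext i
  have h1 := Real.sqrt_pos.mpr (hs i)
  rw [Real.sqrt_mul (hx i).le]
  nth_rewrite 1 [← Real.mul_self_sqrt (hs i).le]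
  field_simp

/-- If `A D W` has full row rank then the perturbation vector solves its equation exactly. -/
theorem mulVec_perturbation_of_rank_eq (hx : ∀ i, 0 < x i) (hs : ∀ i, 0 < s i) {w : ℕ}
    {W : Matrix (Fin n) (Fin w) ℝ} (hW : (A * scaling x s * W).rank = m) (dy p : Fin m → ℝ) :
    (A * (Matrix.diagonal s)⁻¹).mulVec (perturbation A x s W dy p)
      = (A * scaling x s ^ 2 * A.transpose).mulVec dy - p := by
  have h : A * (Matrix.diagonal s)⁻¹
      * (Matrix.diagonal (fun i => √(x i * s i)) * W * pinv (A * scaling x s * W)) = 1 := by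
    rw [← mul_pinv_of_rank_eq hW]
    generalize pinv (A * scaling x s * W) = N
    rw [← inv_diagonal_mul_sqrt hx hs]
    simp only [Matrix.mul_assoc]
  rw [perturbation, Matrix.mulVec_mulVec, h, Matrix.one_mulVec]

end Scaling

/-! ### Rank preservation from the sketching guarantee. -/

section SketchGuarantee

open scoped Matrix.Norms.L2Operator

theorem exists_orthonormal_rows {m n : ℕ} {B : Matrix (Fin m) (Fin n) ℝ} (hB : B.rank = m) :
    ∃ Z : Matrix (Fin m) (Fin n) ℝ, Z * Z.transpose = 1 ∧
      ∀ u ∈ rowSpace B, ∃ y : Fin m → ℝ, u.ofLp = Z.transpose.mulVec y := by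
  let b := (stdOrthonormalBasis ℝ (rowSpace B)).reindex (finCongr (finrank_rowSpace hB))
  refine ⟨Matrix.of fun k i => (b k).1.ofLp i, ?_, fun u hu => ⟨fun k => b.repr ⟨u, hu⟩ k, ?_⟩⟩
  · ext k l
    have h := orthonormal_iff_ite.mp b.orthonormal k l
    rw [Submodule.coe_inner, EuclideanSpace.inner_eq_star_dotProduct, star_trivial,
      dotProduct_comm] at h
    rw [Matrix.one_apply, ← h]
    rfl
  · have h := congrArg (fun v : rowSpace B => v.1.ofLp) (b.sum_repr ⟨u, hu⟩)
    simp only at h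
    rw [← h]
    funext i
    simp [Matrix.mulVec, dotProduct, mul_comm]

/-- A sketch that is accurate on an orthonormal basis `Z` of the row space of `B` preserves the
rank of `B`. -/
theorem rank_mul_eq_of_norm_sub_lt_one {m n w : ℕ} {B Z : Matrix (Fin m) (Fin n) ℝ}
    (hB : B.rank = m) (hspan : ∀ u ∈ rowSpace B, ∃ y : Fin m → ℝ, u.ofLp = Z.transpose.mulVec y)
    {W : Matrix (Fin n) (Fin w) ℝ} (hW : ‖Z * W * W.transpose * Z.transpose - 1‖ < 1) :
    (B * W).rank = m := by
  refine rank_mul_eq_of_rowSpace hB fun u hu hWu => ?_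
  obtain ⟨y, hy⟩ := hspan u hu
  -- A vector lost by the sketch is an eigenvector of the error with eigenvalue `-1`, impossible for
  -- norm below `1` unless `y = 0`.
  have h1 : (Z * W * W.transpose * Z.transpose - 1).mulVec y = -y := by
    rw [Matrix.sub_mulVec, Matrix.one_mulVec, ← Matrix.mulVec_mulVec, ← hy, ← Matrix.mulVec_mulVec,
      hWu, Matrix.mulVec_zero, zero_sub]
  have h2 := Matrix.l2_opNorm_mulVec (Z * W * W.transpose * Z.transpose - 1) (WithLp.toLp 2 y)
  simp only at h2
  rw [h1] at h2
  have h3 : ‖(EuclideanSpace.equiv (Fin m) ℝ).symm (-y)‖ = ‖WithLp.toLp 2 y‖ := by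
    rw [map_neg, norm_neg]
    rfl
  rw [h3] at h2
  have h4 : ‖WithLp.toLp 2 y‖ = 0 := by
    nlinarith [norm_nonneg (WithLp.toLp 2 y)]
  have h5 : y = 0 := by simpa using h4
  apply WithLp.ofLp_injective 2
  rw [hy, h5, Matrix.mulVec_zero]
  rfl

theorem le_measure_rank_mul_of_sketchGuarantee {m n w : ℕ} (hm : 0 < m)
    {B : Matrix (Fin m) (Fin n) ℝ} (hB : B.rank = m)
    {P : MeasureTheory.Measure (Matrix (Fin n) (Fin w) ℝ)} {ζ δ : ℝ} (hζ : ζ ≤ 1)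
    (hP : SketchGuarantee P ζ δ m) :
    ENNReal.ofReal (1 - δ) ≤ P {W | (B * W).rank = m} := by
  obtain ⟨Z, hZ, hspan⟩ := exists_orthonormal_rows hB
  refine (hP m Z).trans (MeasureTheory.measure_mono fun W hW => ?_)
  rw [Set.mem_ofPred_eq, hZ] at hW
  refine rank_mul_eq_of_norm_sub_lt_one hB hspan (hW.trans_lt ?_)
  -- With `r = m` both terms of the guarantee are at most `1`, so the error is at most `ζ / 2`.
  have hF : ∑ i, ∑ j, Z i j ^ 2 = m := by
    have h : ∀ i, ∑ j, Z i j ^ 2 = 1 := fun i => by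
      have := congrFun (congrFun hZ i) i
      rw [Matrix.mul_apply, Matrix.one_apply_eq] at this
      rw [← this]
      exact Finset.sum_congr rfl fun j _ => by rw [Matrix.transpose_apply, sq]
    simp [h]
  have hN : ‖Z‖ ^ 2 ≤ 1 := by
    have : Nonempty (Fin m) := ⟨⟨0, hm⟩⟩
    have h := Matrix.l2_opNorm_conjTranspose_mul_self Z.transpose
    have h' : ‖Z.transpose‖ = ‖Z‖ := by
      rw [← Matrix.conjTranspose_eq_transpose_of_trivial, Matrix.l2_opNorm_conjTranspose]
    rw [Matrix.conjTranspose_eq_transpose_of_trivial, Matrix.transpose_transpose, hZ, h',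
      CStarRing.norm_one] at h
    rw [sq, ← h]
  have hm' : (m : ℝ) ≠ 0 := by positivity
  rw [hF, div_self hm']
  nlinarith

end SketchGuarantee

/-! ### Rank preservation by the sparse sketch. -/

theorem sparseSketch_transpose_mulVec_eq_zero {n q t : ℕ} (hq : 0 < q)
    {ω : Fin n → Fin q → Fin t × Bool} {u : EuclideanSpace ℝ (Fin n)}
    (hu : (sparseSketch ω).transpose.mulVec u.ofLp = 0) (a : Fin q) :
    u ∈ sketchKer fun i => ω i a := by
  rw [mem_sketchKer]
  funext b
  have hq' : (√(q : ℝ)) ≠ 0 := (Real.sqrt_pos.mpr (by exact_mod_cast hq)).ne'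
  have h := congrFun hu (finProdFinEquiv (a, b))
  have hdiv : (finProdFinEquiv (a, b)).divNat = a :=
    congrArg Prod.fst (finProdFinEquiv.symm_apply_apply (a, b))
  have hmod : (finProdFinEquiv (a, b)).modNat = b :=
    congrArg Prod.snd (finProdFinEquiv.symm_apply_apply (a, b))
  simp only [Matrix.mulVec, dotProduct, Matrix.transpose_apply, sparseSketch, Matrix.of_apply,
    hdiv, hmod, Pi.zero_apply] at h
  simp only [Matrix.mulVec, dotProduct, Matrix.transpose_apply, countSketch, Matrix.of_apply,
    Pi.zero_apply]
  refine Eq.trans ?_ ((congrArg (√(q : ℝ) * ·) h).trans (mul_zero _))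
  simp only [Finset.mul_sum]
  refine Finset.sum_congr rfl fun i _ => ?_
  by_cases e : (ω i a).1 = b
  · simp only [if_pos e]
    field_simp
  · simp only [if_neg e, zero_mul, mul_zero]

/-- A set whose complement has at most a fraction `δ` of the points of a finite type has
probability at least `1 - δ` under the uniform distribution. -/
theorem ofReal_one_sub_le_uniformOn {Ω : Type*} [Fintype Ω] [Nonempty Ω] [MeasurableSpace Ω]
    [MeasurableSingletonClass Ω] {δ : ℝ} (f : Ω → ℕ) {S : Set Ω} (hS : ∀ ω, f ω = 0 → ω ∈ S)
    (hf : ∑ ω, (f ω : ℝ) ≤ Fintype.card Ω * δ) :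
    ENNReal.ofReal (1 - δ) ≤ ProbabilityTheory.uniformOn Set.univ S := by
  classical
  let T : Finset Ω := Finset.univ.filter fun ω => f ω = 0
  have hcard : (0 : ℝ) < Fintype.card Ω := by exact_mod_cast Fintype.card_pos
  have hT : Fintype.card Ω * (1 - δ) ≤ (T.card : ℝ) := by
    -- Markov's inequality for an integer-valued variable: each point with `f ω ≠ 0` contributes at
    -- least `1`.
    have h1 : (Fintype.card Ω : ℝ) - T.card ≤ ∑ ω, (f ω : ℝ) := by
      rw [Finset.cast_card, Finset.sum_filter, ← Finset.card_univ, Finset.cast_card,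
        ← Finset.sum_sub_distrib]
      refine Finset.sum_le_sum fun ω _ => ?_
      split_ifs with h
      · simp [h]
      · have : 1 ≤ f ω := Nat.one_le_iff_ne_zero.mpr h
        simpa using this
    linarith
  calc ENNReal.ofReal (1 - δ) ≤ ENNReal.ofReal (T.card / Fintype.card Ω) :=
        ENNReal.ofReal_le_ofReal ((le_div_iff₀ hcard).mpr (by linarith))
    _ = ProbabilityTheory.uniformOn Set.univ (T : Set Ω) := by
        rw [ProbabilityTheory.uniformOn_univ, MeasureTheory.Measure.count_apply_finset,
          ENNReal.ofReal_div_of_pos hcard, ENNReal.ofReal_natCast, ENNReal.ofReal_natCast]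
    _ ≤ _ := MeasureTheory.measure_mono fun ω hω => hS ω (Finset.mem_filter.mp hω).2

theorem le_sparseSketchLaw_rank_mul {m n q t : ℕ} (hm : 0 < m) {B : Matrix (Fin m) (Fin n) ℝ}
    (hB : B.rank = m) {δ : ℝ} (hδ0 : 0 < δ) (hδ : δ < 1) (hq : 6 * Real.log (m / δ) ≤ q)
    (ht : 6 * (m : ℝ) ≤ t) :
    ENNReal.ofReal (1 - δ) ≤ sparseSketchLaw n q t {W | (B * W).rank = m} := by
  have hm1 : (1 : ℝ) ≤ m := by exact_mod_cast hm
  have htpos : (0 : ℝ) < t := by linarith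
  have : Nonempty (Fin t) := ⟨⟨0, by exact_mod_cast htpos⟩⟩
  have hlog : 0 < Real.log (m / δ) := Real.log_pos (by rw [lt_div_iff₀ hδ0]; linarith)
  have hqpos : 0 < q := by
    have : (0 : ℝ) < q := by linarith
    exact_mod_cast this
  have hmeas : Measurable (sparseSketch : (Fin n → Fin q → Fin t × Bool) → _) :=
    measurable_of_countable _
  -- This inequality for the image measure holds for every set, so measurability of the rank event
  -- is not needed.
  refine le_trans ?_ (MeasureTheory.Measure.le_map_apply hmeas.aemeasurable _)
  refine ofReal_one_sub_le_uniformOn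
    (fun ω => Module.finrank ℝ ↥(rowSpace B ⊓ ⨅ a, sketchKer fun i => ω i a)) (fun ω hω => ?_) ?_
  · refine rank_mul_eq_of_rowSpace hB fun u hu hWu => ?_
    rw [Submodule.finrank_eq_zero] at hω
    rw [← Submodule.mem_bot ℝ, ← hω]
    exact ⟨hu, (Submodule.mem_iInf _).mpr (sparseSketch_transpose_mulVec_eq_zero hqpos hWu)⟩
  have hstep : ∀ L : Submodule ℝ (EuclideanSpace ℝ (Fin n)), Module.finrank ℝ L ≤ m →
      ∑ h : Fin n → Fin t × Bool, (Module.finrank ℝ ↥(L ⊓ sketchKer h) : ℝ)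
        ≤ Fintype.card (Fin n → Fin t × Bool) * (Real.exp (-1) * Module.finrank ℝ L) := by
    intro L hL
    have hL' : (Module.finrank ℝ L : ℝ) ≤ m := by exact_mod_cast hL
    have he : 1 ≤ 3 * Real.exp (-1) := by
      have h1 := Real.exp_one_lt_d9
      have h2 : Real.exp (-1) * Real.exp 1 = 1 := by rw [← Real.exp_add]; simp
      nlinarith [Real.exp_pos (-1)]
    -- `2 dim L ≤ 2m ≤ t/3 ≤ t/e`: the constant `6` is the `2` of the second moment times `3 > e`.
    have hkey : 2 * (Module.finrank ℝ L : ℝ) ≤ t * Real.exp (-1) := by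
      nlinarith [Real.exp_pos (-1)]
    refine le_of_mul_le_mul_left ((sum_finrank_inf_sketchKer_le L).trans ?_) htpos
    rw [mul_left_comm (t : ℝ)]
    refine mul_le_mul_of_nonneg_left ?_ (Nat.cast_nonneg _)
    nlinarith [Nat.cast_nonneg (α := ℝ) (Module.finrank ℝ L)]
  have hsum := sum_finrank_inf_iInf_le (sketchKer (n := n) (t := t)) (Real.exp_pos (-1)).le hstep q
    (rowSpace B) (finrank_rowSpace hB).le
  -- The sketch indexes its choices by row then block; the independence argument needs block then
  -- row.
  rw [finrank_rowSpace hB, ← Fintype.card_congr (Equiv.piComm fun _ _ => Fin t × Bool)] at hsum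
  refine le_trans (le_of_eq ?_) (hsum.trans (mul_le_mul_of_nonneg_left ?_ (Nat.cast_nonneg _)))
  · exact Fintype.sum_equiv (Equiv.piComm fun _ _ => Fin t × Bool) _ _ fun _ => rfl
  · calc Real.exp (-1) ^ q * m = Real.exp (-q) * m := by
          rw [← Real.exp_nat_mul]
          simp
      _ ≤ Real.exp (-Real.log (m / δ)) * m := by
          gcongr
          linarith
      _ = δ := by
          rw [Real.exp_neg, Real.exp_log (by positivity)]
          field_simp

/-! ### The lemma, with both parts reduced to the rank event. -/

theorem mainTheorem4 :
    ∃ C : ℝ, 0 < C ∧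
      ∀ (m n : ℕ) (A : Matrix (Fin m) (Fin n) ℝ) (x s : Fin n → ℝ) (δ : ℝ),
        0 < m → A.rank = m → (∀ i, 0 < x i) → (∀ i, 0 < s i) → 0 < δ → δ < 1 →
        (∀ q t : ℕ, C * Real.log (m / δ) ≤ q → C * m ≤ t →
          ENNReal.ofReal (1 - δ) ≤ sparseSketchLaw n q t
            {W | (A * scaling x s * W).rank = m ∧
              ∀ dy p : Fin m → ℝ,
                (A * (Matrix.diagonal s)⁻¹).mulVec (perturbation A x s W dy p)
                  = (A * scaling x s ^ 2 * A.transpose).mulVec dy - p}) ∧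
        (∀ (w : ℕ) (ζ : ℝ) (P : MeasureTheory.Measure (Matrix (Fin n) (Fin w) ℝ)),
          MeasureTheory.IsProbabilityMeasure P → 0 ≤ ζ → ζ ≤ 1 → SketchGuarantee P ζ δ m →
          ENNReal.ofReal (1 - δ) ≤ P
            {W | (A * scaling x s * W).rank = m ∧
              ∀ dy p : Fin m → ℝ,
                (A * (Matrix.diagonal s)⁻¹).mulVec (perturbation A x s W dy p)
                  = (A * scaling x s ^ 2 * A.transpose).mulVec dy - p}) := by
  refine ⟨6, by norm_num, fun m n A x s δ hm hA hx hs hδ0 hδ => ?_⟩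
  have hB : (A * scaling x s).rank = m := (rank_mul_scaling A hx hs).trans hA
  have hsub : ∀ w : ℕ, {W : Matrix (Fin n) (Fin w) ℝ | (A * scaling x s * W).rank = m} ⊆
      {W | (A * scaling x s * W).rank = m ∧
        ∀ dy p : Fin m → ℝ,
          (A * (Matrix.diagonal s)⁻¹).mulVec (perturbation A x s W dy p)
            = (A * scaling x s ^ 2 * A.transpose).mulVec dy - p} :=
    fun w W hW => ⟨hW, mulVec_perturbation_of_rank_eq A hx hs hW⟩
  refine ⟨fun q t hq ht => ?_, fun w ζ P _ _ hζ hP => ?_⟩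
  · exact (le_sparseSketchLaw_rank_mul hm hB hδ0 hδ hq ht).trans
      (MeasureTheory.measure_mono (hsub _))
  · exact (le_measure_rank_mul_of_sketchGuarantee hm hB hζ hP).trans
      (MeasureTheory.measure_mono (hsub _))
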